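/- Let $n\ge 1$ be an integer and put $$T_n=\inf_{|z_1|\ge 1,\dots,|z_n|\ge 1}\ \max_{\nu=1,\dots,n^2}\left|\sum_{k=1}^n z_k^\nu\right|,$$ where the infimum is over all $n$-tuples of complex numbers $(z_1,\dots,z_n)$ with $|z_k|\ge 1$ for every $k$. (i) If $j\ge 0$ is an integer and $n+j+1$ is prime, then $\sqrt n\le T_n\le \sqrt{n+j+1}+j$. (ii) If $j\ge 1$ is an integer and $n+j$ is a prime power, then $\sqrt n\le T_n\le \sqrt{n+j}+j$. (iii) If $n$ is a prime power, then $\sqrt n\le T_n\le \sqrt n+1$. (A prime power is a number $p^a$ with $p$ prime and $a\ge 1$.) -/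

import Mathlib

/-- The pure power sum `z_1 ^ ν + ⋯ + z_n ^ ν`. -/
noncomputable def powerSum {n : ℕ} (z : Fin n → ℂ) (ν : ℕ) : ℂ :=
  ∑ k, z k ^ ν

/-- The maximum of `|z_1 ^ ν + ⋯ + z_n ^ ν|` over the integers `1 ≤ ν ≤ m`. -/
noncomputable def maxPowerSum {n : ℕ} (m : ℕ) (z : Fin n → ℂ) : ℝ :=
  ((Finset.Icc 1 m).sup fun ν => ‖powerSum z ν‖₊ : NNReal)

/-- The infimum, over all `n`-tuples of complex numbers with `|z_k| ≥ 1` for every `k`, of the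
maximum of `|z_1 ^ ν + ⋯ + z_n ^ ν|` over the integers `1 ≤ ν ≤ m`. -/
noncomputable def infMaxPowerSum (n m : ℕ) : ℝ :=
  ⨅ z : {z : Fin n → ℂ // ∀ k, 1 ≤ ‖z k‖}, maxPowerSum m z.1

/-- The maximum is attained and is an upper bound. -/
theorem isGreatest_maxPowerSum {n m : ℕ} (hm : 1 ≤ m) (z : Fin n → ℂ) :
    IsGreatest ((fun ν : ℕ => ‖powerSum z ν‖) '' Set.Icc 1 m) (maxPowerSum m z) := by
  constructor
  · obtain ⟨ν, hν, h⟩ := Finset.exists_mem_eq_sup (Finset.Icc 1 m)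
      (Finset.nonempty_Icc.2 hm) (fun ν => ‖powerSum z ν‖₊)
    refine ⟨ν, by simpa using hν, ?_⟩
    rw [maxPowerSum, h]
    rfl
  · rintro _ ⟨ν, hν, rfl⟩
    have h := Finset.le_sup (f := fun ν => ‖powerSum z ν‖₊) (Finset.mem_Icc.2 hν)
    exact_mod_cast h

/-- The infimum is a genuine greatest lower bound. -/
theorem isGLB_infMaxPowerSum (n m : ℕ) :
    IsGLB (maxPowerSum m '' {z : Fin n → ℂ | ∀ k, 1 ≤ ‖z k‖}) (infMaxPowerSum n m) := by
  have hne : Nonempty {z : Fin n → ℂ // ∀ k, 1 ≤ ‖z k‖} := ⟨⟨fun _ => 1, by simp⟩⟩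
  have h := isGLB_ciInf (f := fun z : {z : Fin n → ℂ // ∀ k, 1 ≤ ‖z k‖} => maxPowerSum m z.1)
    ⟨0, by rintro _ ⟨z, rfl⟩; exact NNReal.coe_nonneg _⟩
  rw [Set.image_eq_range]
  exact h

/-! Lower bound: the `n² - n` products `z_j * conj z_k` with `j ≠ k` have power sums `|s_ν|² - ∑
|z_k|^{2ν}`. By Newton's identities these cannot all be negative for `ν ≤ n² - n + 1`, so some
`|s_ν|²` is at least `n`.

Upper bound: take a family in a finite cyclic group `G` whose off-diagonal quotients cover the
complement of a small set `Z` exactly once. Then `|∑ χ (f i)|² = card ι - ∑_Z χ` for every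
nontrivial character `χ`. The values of a character of full order are unimodular numbers whose power
sums are thus controlled for all `ν < card G`; deleting `j` of them costs at most `j`. The families
are those of Ruzsa type in `ZMod p × (ZMod p)ˣ` for (i), of Bose in `Lˣ` with `L` quadratic over `F`
for (ii), and of Singer in `Lˣ / Fˣ` with `L` cubic for (iii). -/

/-! ### Lower bound by Newton's identities -/

open scoped ComplexOrder in
/-- If the power sums `p_1, …, p_{N+1}` of `N` complex numbers could all be negative, Newton's
identities would force the vanishing elementary symmetric polynomial `e_{N+1}` to be nonzero. -/
theorem exists_sum_pow_not_neg {σ : Type*} [Fintype σ] (w : σ → ℂ) :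
    ∃ ν ∈ Finset.Icc 1 (Fintype.card σ + 1), ¬ ∑ i, w i ^ ν < 0 := by
  classical
  by_contra! h
  set e : ℕ → ℂ := fun k => (-1) ^ k * MvPolynomial.aeval w (MvPolynomial.esymm σ ℂ k) with he
  have newton : ∀ k : ℕ, (k : ℂ) * e k =
      -∑ a ∈ Finset.HasAntidiagonal.antidiagonal k with a.1 < k, e a.1 * ∑ i, w i ^ a.2 := by
    intro k
    have := congrArg (MvPolynomial.aeval w) (MvPolynomial.mul_esymm_eq_sum σ ℂ k)
    simp only [map_mul, map_natCast, map_pow, map_neg, map_one, map_sum, MvPolynomial.psum,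
      MvPolynomial.aeval_X] at this
    simp only [he]
    rw [mul_left_comm, this, ← mul_assoc, ← pow_add]
    have h1 : (-1 : ℂ) ^ (k + (k + 1)) = -1 := Odd.neg_one_pow ⟨k, by ring⟩
    rw [h1, neg_one_mul]
  -- The signs in `e` turn Newton's recursion into one with positive terms, starting from `e 0 = 1`.
  have pos : ∀ k ≤ Fintype.card σ + 1, 0 < e k := by
    intro k
    induction k using Nat.strong_induction_on with
    | _ k ih =>
      intro hk
      rcases Nat.eq_zero_or_pos k with rfl | hk0
      · simp [he]
      · have hsum : 0 < -∑ a ∈ Finset.HasAntidiagonal.antidiagonal k with a.1 < k, e a.1 * ∑ i, w i ^ a.2 := by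
          rw [← Finset.sum_neg_distrib]
          refine Finset.sum_pos (fun a ha => ?_) ⟨(0, k), by simp [hk0]⟩
          simp only [Finset.mem_filter, Finset.HasAntidiagonal.mem_antidiagonal] at ha
          rw [← mul_neg]
          exact mul_pos (ih a.1 ha.2 (by omega))
            (neg_pos.2 (h a.2 (Finset.mem_Icc.2 ⟨by omega, by omega⟩)))
        rw [← newton] at hsum
        exact (mul_pos_iff_of_pos_left (Nat.cast_pos.2 hk0)).1 hsum
  have hlast := pos _ le_rfl
  rw [he] at hlast
  simp [MvPolynomial.esymm, Finset.powersetCard_eq_empty.2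
    (show (Finset.univ : Finset σ).card < Fintype.card σ + 1 by simp)] at hlast

open ComplexConjugate in
/-- Off-diagonal products `z_j * conj z_k` have power sums `|s_ν|² - ∑ |z_k|^{2ν}`. -/
theorem sum_offDiag_pow_mul_conj {n : ℕ} (z : Fin n → ℂ) (ν : ℕ) :
    ∑ x : {x : Fin n × Fin n // x.1 ≠ x.2}, (z x.1.1 * conj (z x.1.2)) ^ ν =
      ((‖powerSum z ν‖ ^ 2 - ∑ k, (‖z k‖ ^ 2) ^ ν : ℝ) : ℂ) := by
  have h1 : ∑ x : Fin n × Fin n, (z x.1 * conj (z x.2)) ^ ν = ((‖powerSum z ν‖ ^ 2 : ℝ) : ℂ) := by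
    rw [Complex.ofReal_pow, ← Complex.mul_conj', powerSum, map_sum, Finset.sum_mul_sum,
      Fintype.sum_prod_type]
    simp [mul_pow]
  have h2 := Fintype.sum_subtype_add_sum_subtype (fun x : Fin n × Fin n => x.1 = x.2)
    (fun x => (z x.1 * conj (z x.2)) ^ ν)
  have h3 : ∑ x : {x : Fin n × Fin n // x.1 = x.2}, (z x.1.1 * conj (z x.1.2)) ^ ν =
      ((∑ k, (‖z k‖ ^ 2) ^ ν : ℝ) : ℂ) := by
    push_cast
    refine Fintype.sum_bijective (fun x => x.1.1) ⟨?_, fun k => ⟨⟨(k, k), rfl⟩, rfl⟩⟩ _ _ ?_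
    · rintro ⟨⟨a, b⟩, hab⟩ ⟨⟨c, d⟩, hcd⟩ h
      simp only at hab hcd h
      subst hab hcd h
      rfl
    · rintro ⟨⟨a, b⟩, hab⟩
      simp only at hab
      simp [hab, Complex.mul_conj']
  rw [h1, h3] at h2
  rw [Complex.ofReal_sub, ← h2, add_sub_cancel_left]

theorem card_offDiag_fin (n : ℕ) :
    Fintype.card {x : Fin n × Fin n // x.1 ≠ x.2} = n * n - n := by
  rw [Fintype.card_subtype]
  have := Finset.offDiag_card (Finset.univ : Finset (Fin n))
  rw [Finset.card_univ, Fintype.card_fin] at this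
  rw [← this]
  congr 1
  ext x
  simp

theorem sqrt_le_maxPowerSum {n : ℕ} (hn : 1 ≤ n) (z : Fin n → ℂ) (hz : ∀ k, 1 ≤ ‖z k‖) :
    Real.sqrt n ≤ maxPowerSum (n ^ 2) z := by
  obtain ⟨ν, hν, hneg⟩ := exists_sum_pow_not_neg
    (fun x : {x : Fin n × Fin n // x.1 ≠ x.2} => z x.1.1 * (starRingEnd ℂ) (z x.1.2))
  rw [sum_offDiag_pow_mul_conj, ← Complex.ofReal_zero, Complex.real_lt_real, not_lt,
    sub_nonneg] at hneg
  rw [card_offDiag_fin, Finset.mem_Icc] at hν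
  have hle : ν ≤ n ^ 2 := by
    have : n ≤ n * n := Nat.le_mul_self n
    rw [sq]; omega
  have hsum : (n : ℝ) ≤ ∑ k, (‖z k‖ ^ 2) ^ ν := by
    have := Finset.sum_le_sum (s := Finset.univ) fun k _ =>
      one_le_pow₀ (n := ν) (one_le_pow₀ (n := 2) (hz k))
    simpa using this
  refine (Real.sqrt_le_left (norm_nonneg (powerSum z ν))).2 (hsum.trans hneg) |>.trans ?_
  exact (isGreatest_maxPowerSum (Nat.one_le_pow 2 n hn) z).2 ⟨ν, ⟨hν.1, hle⟩, rfl⟩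

theorem sqrt_le_infMaxPowerSum {n : ℕ} (hn : 1 ≤ n) :
    Real.sqrt n ≤ infMaxPowerSum n (n ^ 2) := by
  refine (isGLB_infMaxPowerSum n (n ^ 2)).2 ?_
  rintro _ ⟨z, hz, rfl⟩
  exact sqrt_le_maxPowerSum hn z hz

/-! ### Upper bounds from families with distinct quotients -/

/-- Deleting entries from a finite family of unimodular numbers with small power sums. -/
theorem infMaxPowerSum_le_of_family {ι : Type*} [Fintype ι] {n m j : ℕ} (hm : 1 ≤ m)
    (hcard : Fintype.card ι = n + j) (z : ι → ℂ) (hz : ∀ i, ‖z i‖ = 1) {B : ℝ}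
    (hB : ∀ ν ∈ Set.Icc 1 m, ‖∑ i, z i ^ ν‖ ≤ B) :
    infMaxPowerSum n m ≤ B + j := by
  classical
  have e : Fin n ⊕ Fin j ≃ ι := Fintype.equivOfCardEq (by simp [hcard])
  refine ((isGLB_infMaxPowerSum n m).1 ⟨fun k => z (e (.inl k)), fun k => (hz _).ge, rfl⟩).trans ?_
  obtain ⟨ν, hν, h⟩ := (isGreatest_maxPowerSum hm fun k => z (e (.inl k))).1
  rw [← h]
  have hsplit : ∑ i, z i ^ ν = powerSum (fun k => z (e (.inl k))) ν +
      ∑ k, z (e (.inr k)) ^ ν := by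
    rw [← e.sum_comp, Fintype.sum_sum_type, powerSum]
  have htail : ‖∑ k, z (e (.inr k)) ^ ν‖ ≤ j := by
    refine (norm_sum_le _ _).trans ?_
    simp [norm_pow, hz]
  simp only [eq_sub_of_add_eq hsplit.symm]
  exact (norm_sub_le _ _).trans (add_le_add (hB ν hν) htail)

/-- A family in a finite abelian group whose off-diagonal quotients are pairwise distinct and
cover exactly the complement of `Z`. -/
structure HasDistinctQuotients {G ι : Type*} [CommGroup G] [Fintype G] [Fintype ι]
    (f : ι → G) (Z : Finset G) : Prop where
  eq_of_div_eq : ∀ i j k l, i ≠ j → k ≠ l → f i / f j = f k / f l → i = k ∧ j = l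
  div_notMem : ∀ i j, i ≠ j → f i / f j ∉ Z
  card_add : Z.card + (Fintype.card ι * Fintype.card ι - Fintype.card ι) = Fintype.card G

theorem norm_monoidHom_eq_one {G : Type*} [CommGroup G] [Finite G] (χ : G →* ℂ) (g : G) :
    ‖χ g‖ = 1 :=
  (χ.isOfFinOrder (isOfFinOrder_of_finite g)).norm_eq_one

open ComplexConjugate in
theorem monoidHom_div_eq_mul_conj {G : Type*} [CommGroup G] [Finite G] (χ : G →* ℂ) (g h : G) :
    χ (g / h) = χ g * conj (χ h) := by
  have h1 : χ (g / h) * χ h = χ g := by rw [← map_mul, div_mul_cancel]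
  have h2 : χ h * conj (χ h) = 1 := by simp [Complex.mul_conj', norm_monoidHom_eq_one]
  rw [← h1, mul_assoc, h2, mul_one]

/-- Expanding the square gives `card ι` from the diagonal and each element outside `Z` once from the
rest; a nontrivial character sums to zero over `G`. -/
theorem HasDistinctQuotients.norm_sum_sq {G ι : Type*} [CommGroup G] [Fintype G] [Fintype ι]
    {f : ι → G} {Z : Finset G} (hf : HasDistinctQuotients f Z) {χ : G →* ℂ} (hχ : χ ≠ 1) :
    ((‖∑ i, χ (f i)‖ ^ 2 : ℝ) : ℂ) = Fintype.card ι - ∑ g ∈ Z, χ g := by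
  classical
  set D : Finset G := (Finset.univ : Finset ι).offDiag.image fun x => f x.1 / f x.2 with hD
  have hinj : Set.InjOn (fun x : ι × ι => f x.1 / f x.2) (Finset.univ : Finset ι).offDiag := by
    rintro ⟨i, j⟩ hij ⟨k, l⟩ hkl h
    simp only [Finset.coe_offDiag, Set.mem_offDiag] at hij hkl
    obtain ⟨rfl, rfl⟩ := hf.eq_of_div_eq i j k l hij.2.2 hkl.2.2 h
    rfl
  have hdisj : Disjoint Z D := by
    rw [Finset.disjoint_right]
    intro g hg
    simp only [hD, Finset.mem_image, Finset.mem_offDiag] at hg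
    obtain ⟨x, hx, rfl⟩ := hg
    exact hf.div_notMem _ _ hx.2.2
  have hunion : Z ∪ D = Finset.univ := by
    rw [← Finset.card_eq_iff_eq_univ, Finset.card_union_of_disjoint hdisj, hD,
      Finset.card_image_of_injOn hinj, Finset.offDiag_card]
    exact hf.card_add
  have hsum : ∑ g ∈ Z, χ g + ∑ x ∈ (Finset.univ : Finset ι).offDiag, χ (f x.1 / f x.2) = 0 := by
    rw [← Finset.sum_image hinj, ← Finset.sum_union hdisj, hunion, sum_hom_units_eq_zero χ hχ]
  have hdiag : ∑ x ∈ (Finset.univ : Finset ι).diag, χ (f x.1 / f x.2) = Fintype.card ι := by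
    simp only [Finset.sum_diag, div_self', map_one]; simp
  rw [Complex.ofReal_pow, ← Complex.mul_conj', map_sum, Finset.sum_mul_sum,
    ← Finset.sum_product']
  simp only [← monoidHom_div_eq_mul_conj]
  rw [← Finset.diag_union_offDiag, Finset.sum_union (Finset.disjoint_diag_offDiag _), hdiag,
    eq_sub_of_add_eq' hsum, zero_sub, sub_eq_add_neg]

/-- A finite cyclic group has a complex character of full order. -/
theorem exists_monoidHom_pow_ne_one (G : Type*) [CommGroup G] [Finite G] [IsCyclic G] :
    ∃ χ : G →* ℂ, ∀ ν ∈ Set.Ico 1 (Nat.card G), χ ^ ν ≠ 1 := by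
  obtain ⟨e⟩ := CommGroup.monoidHom_mulEquiv_of_hasEnoughRootsOfUnity G ℂ
  obtain ⟨g, hg⟩ := IsCyclic.exists_ofOrder_eq_natCard (α := G)
  refine ⟨(Units.coeHom ℂ).comp (e.symm g), fun ν hν h => ?_⟩
  have h1 : (e.symm g) ^ ν = 1 := by
    ext x
    simpa using DFunLike.congr_fun h x
  have h2 : orderOf (e.symm g) = Nat.card G := by rw [← hg, MulEquiv.orderOf_eq]
  exact absurd (Nat.le_of_dvd hν.1 (orderOf_dvd_of_pow_eq_one h1)) (by rw [h2]; exact hν.2.not_ge)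

theorem HasDistinctQuotients.infMaxPowerSum_le {G ι : Type*} [CommGroup G] [Fintype G]
    [IsCyclic G] [Fintype ι] {f : ι → G} {Z : Finset G} (hf : HasDistinctQuotients f Z)
    {n m j : ℕ} (hm : 1 ≤ m) (hmG : m < Fintype.card G) (hcard : Fintype.card ι = n + j) {C : ℝ}
    (hC : ∀ χ : G →* ℂ, χ ≠ 1 → (Fintype.card ι : ℝ) - (∑ g ∈ Z, χ g).re ≤ C) :
    infMaxPowerSum n m ≤ Real.sqrt C + j := by
  obtain ⟨χ, hχ⟩ := exists_monoidHom_pow_ne_one G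
  refine infMaxPowerSum_le_of_family hm hcard (fun i => χ (f i))
    (fun i => norm_monoidHom_eq_one χ _) fun ν hν => ?_
  have hν' : χ ^ ν ≠ 1 := hχ ν ⟨hν.1, by rw [Nat.card_eq_fintype_card]; exact hν.2.trans_lt hmG⟩
  have h := congrArg Complex.re (hf.norm_sum_sq hν')
  simp only [Complex.ofReal_re, Complex.sub_re, Complex.natCast_re] at h
  exact Real.le_sqrt_of_sq_le (h.trans_le (hC _ hν'))

/-- The values of a character over a finite group add up to a nonnegative real number. -/
theorem re_sum_monoidHom_nonneg {H : Type*} [Group H] [Fintype H] (χ : H →* ℂ) :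
    0 ≤ (∑ h, χ h).re := by
  classical
  rw [sum_hom_units]
  split_ifs <;> simp

/-! ### Bose and Singer families from a line in a field extension -/

section ProjLine

open Polynomial

/-- Monic polynomials of degree at most one: representatives of the points of a projective line. -/
noncomputable def projLinePoly {F : Type*} [Field F] : Option F → F[X]
  | none => 1
  | some c => X + C c

variable {F : Type*} [Field F]

theorem projLinePoly_monic (i : Option F) : (projLinePoly i).Monic := by
  cases i
  · exact monic_one
  · exact monic_X_add_C _

theorem natDegree_projLinePoly_le (i : Option F) : (projLinePoly i).natDegree ≤ 1 := by
  cases i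
  · simp [projLinePoly]
  · simp [projLinePoly]

theorem isCoprime_projLinePoly {i j : Option F} (h : i ≠ j) :
    IsCoprime (projLinePoly i) (projLinePoly j) := by
  cases i with
  | none => exact isCoprime_one_left
  | some a =>
    cases j with
    | none => exact isCoprime_one_right
    | some b =>
      have hab : -a ≠ -b := fun e => h (by rw [neg_inj.1 e])
      simpa [projLinePoly] using
        isCoprime_X_sub_C_of_isUnit_sub (sub_ne_zero.2 hab).isUnit

theorem projLinePoly_injective : Function.Injective (projLinePoly (F := F)) := by
  intro i j h
  cases i <;> cases j
  · rfl
  · exact absurd (congrArg natDegree h) (by simp [projLinePoly])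
  · exact absurd (congrArg natDegree h) (by simp [projLinePoly])
  · simpa [projLinePoly] using h

/-- Distinct representatives are coprime, so the first factors on the two sides divide each other.
-/
theorem projLinePoly_eq_of_mul_eq {i j k l : Option F} (hij : i ≠ j) (hkl : k ≠ l)
    (h : projLinePoly i * projLinePoly l = projLinePoly k * projLinePoly j) : i = k ∧ j = l := by
  have h1 : projLinePoly i ∣ projLinePoly k :=
    (isCoprime_projLinePoly hij).dvd_of_dvd_mul_right (h ▸ dvd_mul_right _ _)
  have h2 : projLinePoly k ∣ projLinePoly i :=
    (isCoprime_projLinePoly hkl).dvd_of_dvd_mul_right (h ▸ dvd_mul_right _ _)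
  have hik : i = k := projLinePoly_injective
    (eq_of_monic_of_associated (projLinePoly_monic i) (projLinePoly_monic k)
      (associated_of_dvd_dvd h1 h2))
  subst hik
  exact ⟨rfl, (projLinePoly_injective (mul_left_cancel₀ (projLinePoly_monic i).ne_zero h)).symm⟩

variable {L : Type*} [Field L] [Algebra F L] {θ : L}

theorem eq_zero_of_aeval_eq_zero_of_degree_lt_minpoly {p : F[X]}
    (hp : p.degree < (minpoly F θ).degree)
    (h : aeval θ p = 0) : p = 0 := by
  by_contra hne
  exact hp.not_ge (minpoly.degree_le_of_ne_zero F θ hne h)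

theorem Polynomial.Monic.eq_of_aeval_eq_smul {p q : F[X]} (hp : p.Monic) (hq : q.Monic)
    (hpd : p.natDegree < (minpoly F θ).natDegree) (hqd : q.natDegree < (minpoly F θ).natDegree)
    {c : F} (h : aeval θ p = c • aeval θ q) : p = q := by
  have h0 : p - c • q = 0 := by
    refine eq_zero_of_aeval_eq_zero_of_degree_lt_minpoly (θ := θ) ?_ (by simp [h])
    refine (degree_sub_le _ _).trans_lt (max_lt (degree_lt_degree hpd) ?_)
    exact (degree_smul_le _ _).trans_lt (degree_lt_degree hqd)
  have h1 : p = c • q := sub_eq_zero.1 h0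
  have hc : c ≠ 0 := by
    rintro rfl
    exact hp.ne_zero (by simpa using h1)
  have h2 := congrArg Polynomial.leadingCoeff h1
  rw [leadingCoeff_smul_of_smul_regular _ (IsSMulRegular.of_ne_zero hc), hp.leadingCoeff,
    hq.leadingCoeff, smul_eq_mul, mul_one] at h2
  rw [h1, ← h2, one_smul]

theorem Polynomial.Monic.eq_of_aeval_eq {p q : F[X]} (hp : p.Monic) (hq : q.Monic)
    (hpq : p.degree = q.degree) (hpd : p.natDegree ≤ (minpoly F θ).natDegree)
    (hθ : IsIntegral F θ) (h : aeval θ p = aeval θ q) : p = q := by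
  refine sub_eq_zero.1 (eq_zero_of_aeval_eq_zero_of_degree_lt_minpoly (θ := θ) ?_ (by simp [h]))
  refine (degree_sub_lt_left hpq hp.ne_zero (by rw [hp.leadingCoeff, hq.leadingCoeff])).trans_le ?_
  rw [degree_eq_natDegree hp.ne_zero, degree_eq_natDegree (minpoly.ne_zero hθ)]
  exact_mod_cast hpd

theorem aeval_projLinePoly_ne_zero (hθ : 1 < (minpoly F θ).natDegree) (i : Option F) :
    aeval θ (projLinePoly i) ≠ 0 := fun h =>
  (projLinePoly_monic i).ne_zero <| eq_zero_of_aeval_eq_zero_of_degree_lt_minpoly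
    (degree_lt_degree ((natDegree_projLinePoly_le i).trans_lt hθ)) h

/-- The point of the projective line `F + F θ` indexed by `i`, as a unit of `L`. -/
noncomputable def projLineUnit (hθ : 1 < (minpoly F θ).natDegree) (i : Option F) : Lˣ :=
  Units.mk0 _ (aeval_projLinePoly_ne_zero hθ i)

variable (F L) in
/-- The subgroup of `Lˣ` consisting of the nonzero elements of `F`. -/
noncomputable def scalarUnits : Subgroup Lˣ :=
  (Units.map (algebraMap F L : F →* L)).range

theorem unitsMap_algebraMap_injective :
    Function.Injective (Units.map (algebraMap F L : F →* L)) :=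
  Units.map_injective (algebraMap F L).injective

theorem eq_of_projLineUnit_div_mem (hθ : 1 < (minpoly F θ).natDegree) {i j : Option F}
    (h : projLineUnit hθ i / projLineUnit hθ j ∈ scalarUnits F L) : i = j := by
  obtain ⟨c, hc⟩ := h
  refine projLinePoly_injective ((projLinePoly_monic i).eq_of_aeval_eq_smul (θ := θ) (c := c)
    (projLinePoly_monic j) ((natDegree_projLinePoly_le i).trans_lt hθ)
    ((natDegree_projLinePoly_le j).trans_lt hθ) ?_)
  have := congrArg Units.val (eq_div_iff_mul_eq'.1 hc)
  rw [Algebra.smul_def]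
  exact this.symm

theorem card_scalarUnits [Finite F] : Nat.card (scalarUnits F L) = Nat.card F - 1 := by
  rw [← Nat.card_units]
  exact (Nat.card_congr
    (MonoidHom.ofInjective (unitsMap_algebraMap_injective (F := F) (L := L))).toEquiv).symm

/-- Products of two representatives have degree at most 2, below the degree 3 of `θ`, so monicity
recovers them from their values even up to a scalar. -/
theorem hasDistinctQuotients_projLineUnit_mk [Fintype F] [Fintype L]
    [Fintype (Lˣ ⧸ scalarUnits F L)]
    (hL : Fintype.card L = Fintype.card F ^ 3) (hθ : (minpoly F θ).natDegree = 3) :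
    HasDistinctQuotients
      (fun i => (projLineUnit (F := F) (θ := θ) (by omega) i : Lˣ ⧸ scalarUnits F L)) {1} := by
  have hθ' : 1 < (minpoly F θ).natDegree := by omega
  have hdeg : ∀ i j : Option F,
      (projLinePoly i * projLinePoly j).natDegree < (minpoly F θ).natDegree := fun i j => by
    have h1 := natDegree_mul_le (p := projLinePoly i) (q := projLinePoly j)
    have h2 := natDegree_projLinePoly_le i
    have h3 := natDegree_projLinePoly_le j
    omega
  refine ⟨fun i j k l hij hkl h => ?_, fun i j hij h => ?_, ?_⟩
  · rw [div_eq_div_iff_mul_eq_mul, ← QuotientGroup.mk_mul, ← QuotientGroup.mk_mul, eq_comm,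
      QuotientGroup.eq] at h
    obtain ⟨c, hc⟩ := h
    refine projLinePoly_eq_of_mul_eq hij hkl ?_
    refine ((projLinePoly_monic i).mul (projLinePoly_monic l)).eq_of_aeval_eq_smul (θ := θ)
      (c := c) ((projLinePoly_monic k).mul (projLinePoly_monic j)) (hdeg _ _) (hdeg _ _) ?_
    have := congrArg Units.val (eq_inv_mul_iff_mul_eq.1 hc)
    rw [Algebra.smul_def, map_mul, map_mul, mul_comm (algebraMap F L _)]
    exact this.symm
  · rw [Finset.mem_singleton, ← QuotientGroup.mk_div, QuotientGroup.eq_one_iff] at h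
    exact hij (eq_of_projLineUnit_div_mem hθ' h)
  · have h := Subgroup.card_eq_card_quotient_mul_card_subgroup (scalarUnits F L)
    rw [card_scalarUnits, Nat.card_units, Nat.card_eq_fintype_card, Nat.card_eq_fintype_card,
      Nat.card_eq_fintype_card, hL] at h
    rw [Finset.card_singleton, Fintype.card_option]
    obtain ⟨r, hr⟩ : ∃ r, Fintype.card F = r + 1 + 1 :=
      ⟨Fintype.card F - 2, by have := Fintype.one_lt_card (α := F); omega⟩
    rw [hr] at h ⊢
    -- With `q = r + 2` this is `q³ - 1 = (1 + q(q + 1))(q - 1)`; the factor `q - 1` is the order of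
    -- the scalar subgroup.
    have e1 : (r + 1 + 1) ^ 3 - 1 = (1 + (r + 1 + 1) * (r + 1 + 1 + 1)) * (r + 1) := by
      rw [Nat.sub_eq_iff_eq_add (Nat.one_le_pow _ _ (by omega))]; ring
    have e2 : (r + 1 + 1 + 1) * (r + 1 + 1 + 1) - (r + 1 + 1 + 1) =
        (r + 1 + 1) * (r + 1 + 1 + 1) := by
      rw [Nat.sub_eq_iff_eq_add (Nat.le_mul_self _)]; ring
    rw [e1, Nat.add_sub_cancel] at h
    rw [e2]
    exact Nat.eq_of_mul_eq_mul_right (by omega) h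

-- Here products reach the degree 2 of `θ`, so the point at infinity is dropped: all products are
-- then monic of degree exactly 2, and their differences have degree below 2.
open Classical in
theorem hasDistinctQuotients_projLineUnit_some [Fintype F] [Fintype L]
    (hL : Fintype.card L = Fintype.card F ^ 2) (hθ : (minpoly F θ).natDegree = 2) :
    HasDistinctQuotients (fun c => projLineUnit (F := F) (θ := θ) (by omega) (some c))
      (Finset.univ.map ⟨_, unitsMap_algebraMap_injective (F := F) (L := L)⟩) := by
  have hθ' : 1 < (minpoly F θ).natDegree := by omega
  have hint : IsIntegral F θ := by
    by_contra h
    simp [minpoly.eq_zero h] at hθ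
  have hdeg : ∀ i j : F,
      (projLinePoly (some i) * projLinePoly (some j)).degree = 2 := fun i j => by
    rw [degree_mul, projLinePoly, projLinePoly, degree_X_add_C, degree_X_add_C]; rfl
  refine ⟨fun i j k l hij hkl h => ?_, fun i j hij h => ?_, ?_⟩
  · rw [div_eq_div_iff_mul_eq_mul] at h
    have hsome : ∀ {a b : F}, a ≠ b → some a ≠ some b := fun h e => h (Option.some.inj e)
    have key := projLinePoly_eq_of_mul_eq (hsome hij) (hsome hkl) <| by
      refine ((projLinePoly_monic (some i)).mul (projLinePoly_monic (some l))).eq_of_aeval_eq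
        (θ := θ) ((projLinePoly_monic (some k)).mul (projLinePoly_monic (some j)))
        ((hdeg _ _).trans (hdeg _ _).symm) ?_ hint ?_
      · rw [hθ, natDegree_eq_of_degree_eq_some (hdeg i l)]
      · rw [map_mul, map_mul]
        exact congrArg Units.val h
    exact ⟨Option.some.inj key.1, Option.some.inj key.2⟩
  · simp only [Finset.mem_map, Finset.mem_univ, true_and] at h
    exact hij (Option.some.inj (eq_of_projLineUnit_div_mem hθ' h))
  · have h0 := Fintype.one_lt_card (α := F)
    have h1 := Nat.le_mul_self (Fintype.card F)
    rw [Finset.card_map, Finset.card_univ, Fintype.card_units, Fintype.card_units, hL, sq]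
    omega

end ProjLine

/-! ### The family in `ZMod p × (ZMod p)ˣ` -/

/-- The diagonal embedding of `(ZMod p)ˣ` into `ZMod p × (ZMod p)ˣ`. -/
def unitsDiag (p : ℕ) (k : (ZMod p)ˣ) : Multiplicative (ZMod p) × (ZMod p)ˣ :=
  (Multiplicative.ofAdd (k : ZMod p), k)

/-- Inclusion–exclusion for two subgroups meeting in the identity; it serves both to count `Z` and
to sum a character over it. -/
theorem sum_filter_fst_eq_one_or_snd_eq_one (A B : Type*) [Group A] [Group B] [Fintype A]
    [Fintype B] [DecidableEq A] [DecidableEq B] {M : Type*} [AddCommGroup M] (φ : A × B → M) :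
    ∑ x with x.1 = 1 ∨ x.2 = 1, φ x = ∑ a, φ (a, 1) + ∑ b, φ (1, b) - φ 1 := by
  rw [Finset.filter_or, eq_sub_iff_add_eq]
  have h : φ 1 = ∑ x ∈ (Finset.univ.filter fun x : A × B => x.1 = 1) ∩
      (Finset.univ.filter fun x : A × B => x.2 = 1), φ x := by
    rw [show (Finset.univ.filter fun x : A × B => x.1 = 1) ∩
      (Finset.univ.filter fun x : A × B => x.2 = 1) = {1} by ext x; simp [Prod.ext_iff],
      Finset.sum_singleton]
  rw [h, Finset.sum_union_inter, add_comm]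
  congr 1
  · rw [Finset.sum_filter, Fintype.sum_prod_type]; simp
  · rw [Finset.sum_filter, Fintype.sum_prod_type_right]; simp

theorem hasDistinctQuotients_unitsDiag (p : ℕ) [Fact p.Prime] :
    HasDistinctQuotients (unitsDiag p) (Finset.univ.filter fun x => x.1 = 1 ∨ x.2 = 1) := by
  have hsub : ∀ i j : (ZMod p)ˣ, unitsDiag p i / unitsDiag p j =
      (Multiplicative.ofAdd ((i : ZMod p) - j), i / j) := fun i j => rfl
  refine ⟨fun i j k l hij hkl h => ?_, fun i j hij h => ?_, ?_⟩
  · rw [hsub, hsub, Prod.mk.injEq, div_eq_div_iff_mul_eq_mul] at h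
    obtain ⟨h1, h2⟩ := h
    replace h1 : (i : ZMod p) - j = k - l := h1
    replace h2 : (i : ZMod p) * l = k * j := congrArg Units.val h2
    have hne : (k : ZMod p) - l ≠ 0 := sub_ne_zero.2 fun e => hkl (Units.ext e)
    -- Eliminates `i` between the difference equation and the quotient equation.
    have h3 : ((k : ZMod p) - l) * (l - j) = 0 := by
      linear_combination (l : ZMod p) * h1 * (-1) + h2
    have h4 : (l : ZMod p) = j := sub_eq_zero.1 ((mul_eq_zero.1 h3).resolve_left hne)
    refine ⟨Units.ext ?_, Units.ext h4.symm⟩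
    linear_combination h1 - h4
  · rw [hsub, Finset.mem_filter] at h
    rcases h.2 with h | h
    · exact hij (Units.ext (sub_eq_zero.1 h))
    · exact hij (div_eq_one.1 h)
  · have h1 := sum_filter_fst_eq_one_or_snd_eq_one (Multiplicative (ZMod p)) (ZMod p)ˣ
      (fun _ => (1 : ℤ))
    have hp := (Fact.out : p.Prime).two_le
    simp only [Finset.sum_const, Finset.card_univ, nsmul_eq_mul, mul_one, ZMod.card_units_eq_totient,
      Fintype.card_multiplicative, ZMod.card, Nat.totient_prime (Fact.out : p.Prime)] at h1
    rw [Fintype.card_prod, Fintype.card_multiplicative, ZMod.card, ZMod.card_units]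
    obtain ⟨r, rfl⟩ : ∃ r, p = r + 1 := ⟨p - 1, by omega⟩
    rw [Nat.add_sub_cancel] at h1 ⊢
    zify [Nat.le_mul_self r]
    rw [h1]
    push_cast
    ring

/-! ### The three upper bounds -/

theorem exists_finite_extension_primitive {q : ℕ} (hq : IsPrimePow q) (d : ℕ) [NeZero d] :
    ∃ (F L : Type) (_ : Field F) (_ : Field L) (_ : Algebra F L) (_ : Fintype F) (_ : Fintype L)
      (θ : L), Fintype.card F = q ∧ Fintype.card L = q ^ d ∧ (minpoly F θ).natDegree = d := by
  obtain ⟨p, a, hp, ha, rfl⟩ := (isPrimePow_nat_iff q).1 hq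
  have : Fact p.Prime := ⟨hp⟩
  let F := GaloisField p a
  let L := FiniteField.Extension F p d
  have hF : Nat.card F = p ^ a := GaloisField.card p a ha.ne'
  obtain ⟨θ, hθ⟩ := Field.exists_primitive_element F L
  refine ⟨F, L, inferInstance, inferInstance, inferInstance, Fintype.ofFinite F,
    Fintype.ofFinite L, θ, ?_, ?_, ?_⟩
  · rw [Fintype.card_eq_nat_card, hF]
  · rw [Fintype.card_eq_nat_card, FiniteField.natCard_extension, hF]
  · rw [(Field.primitive_element_iff_minpoly_natDegree_eq F θ).1 hθ,
      FiniteField.finrank_extension]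

theorem infMaxPowerSum_le_of_prime {n j : ℕ} (hn : 1 ≤ n) (hp : (n + j + 1).Prime) :
    infMaxPowerSum n (n ^ 2) ≤ Real.sqrt ((n : ℝ) + j + 1) + j := by
  have : Fact (n + j + 1).Prime := ⟨hp⟩
  have hcyc : IsCyclic (Multiplicative (ZMod (n + j + 1)) × (ZMod (n + j + 1))ˣ) := by
    refine Group.isCyclic_prod_iff.2 ⟨inferInstance, inferInstance, ?_⟩
    rw [Nat.card_eq_fintype_card, Nat.card_eq_fintype_card, Fintype.card_multiplicative,
      ZMod.card, ZMod.card_units]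
    exact (Nat.coprime_self_add_left).2 (Nat.coprime_one_left _)
  refine (hasDistinctQuotients_unitsDiag (n + j + 1)).infMaxPowerSum_le (Nat.one_le_pow _ _ hn)
    ?_ (by rw [ZMod.card_units]; rfl) fun χ hχ => ?_
  · rw [Fintype.card_prod, Fintype.card_multiplicative, ZMod.card, ZMod.card_units,
      Nat.add_sub_cancel]
    nlinarith
  -- The two axes contribute nonnegative sums and the shared identity `-1`, so the squared norm is
  -- at most `(p - 1) + 1 = n + j + 1`.
  · rw [sum_filter_fst_eq_one_or_snd_eq_one, ZMod.card_units, Nat.add_sub_cancel]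
    have h1 := re_sum_monoidHom_nonneg (χ.comp (MonoidHom.inl _ _))
    have h2 := re_sum_monoidHom_nonneg (χ.comp (MonoidHom.inr _ _))
    simp only [MonoidHom.comp_apply, MonoidHom.inl_apply, MonoidHom.inr_apply] at h1 h2
    rw [map_one, Complex.sub_re, Complex.add_re, Complex.one_re]
    push_cast
    linarith

theorem infMaxPowerSum_le_of_isPrimePow_add {n j : ℕ} (hn : 1 ≤ n) (hj : 1 ≤ j)
    (hq : IsPrimePow (n + j)) :
    infMaxPowerSum n (n ^ 2) ≤ Real.sqrt ((n : ℝ) + j) + j := by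
  classical
  obtain ⟨F, L, _, _, _, _, _, θ, hF, hL, hθ⟩ := exists_finite_extension_primitive hq 2
  refine (hasDistinctQuotients_projLineUnit_some (hF ▸ hL) hθ).infMaxPowerSum_le
    (Nat.one_le_pow _ _ hn) ?_ hF fun χ hχ => ?_
  · rw [Fintype.card_units, hL]
    -- `j ≥ 1` is needed here: the group has order only `(n + j)² - 1`, which must exceed `n²`.
    have : n ^ 2 + 1 < (n + j) ^ 2 := by nlinarith
    omega
  · have h := re_sum_monoidHom_nonneg (χ.comp (Units.map (algebraMap F L : F →* L)))
    rw [Finset.sum_map, hF]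
    simp only [MonoidHom.comp_apply] at h
    simp only [Function.Embedding.coeFn_mk]
    push_cast
    linarith

theorem infMaxPowerSum_le_of_isPrimePow {n : ℕ} (hn : 1 ≤ n) (hq : IsPrimePow n) :
    infMaxPowerSum n (n ^ 2) ≤ Real.sqrt n + 1 := by
  classical
  obtain ⟨F, L, _, _, _, _, _, θ, hF, hL, hθ⟩ := exists_finite_extension_primitive hq 3
  have : Fintype (Lˣ ⧸ scalarUnits F L) := Fintype.ofFinite _
  have hf := hasDistinctQuotients_projLineUnit_mk (hF ▸ hL) hθ
  have hcyc : IsCyclic (Lˣ ⧸ scalarUnits F L) :=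
    isCyclic_of_surjective (QuotientGroup.mk' (scalarUnits F L)) (QuotientGroup.mk'_surjective _)
  have hcard : Fintype.card (Option F) = n + 1 := by rw [Fintype.card_option, hF]
  -- The summand 1 is the cost of deleting one of the `n + 1` points.
  rw [← Nat.cast_one (R := ℝ)]
  refine hf.infMaxPowerSum_le (Nat.one_le_pow _ _ hn) ?_ hcard fun χ hχ => ?_
  · rw [← hf.card_add, hcard, Finset.card_singleton]
    have : (n + 1) * (n + 1) - (n + 1) = n ^ 2 + n := by
      rw [Nat.sub_eq_iff_eq_add (Nat.le_mul_self _)]; ring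
    omega
  · simp [hF]

theorem mainTheorem7 (n : ℕ) (hn : 1 ≤ n) :
    (∀ j : ℕ, (n + j + 1).Prime →
      Real.sqrt (n : ℝ) ≤ infMaxPowerSum n (n ^ 2) ∧
        infMaxPowerSum n (n ^ 2) ≤ Real.sqrt ((n : ℝ) + (j : ℝ) + 1) + (j : ℝ)) ∧
    (∀ j : ℕ, 1 ≤ j → IsPrimePow (n + j) →
      Real.sqrt (n : ℝ) ≤ infMaxPowerSum n (n ^ 2) ∧
        infMaxPowerSum n (n ^ 2) ≤ Real.sqrt ((n : ℝ) + (j : ℝ)) + (j : ℝ)) ∧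
    (IsPrimePow n →
      Real.sqrt (n : ℝ) ≤ infMaxPowerSum n (n ^ 2) ∧
        infMaxPowerSum n (n ^ 2) ≤ Real.sqrt (n : ℝ) + 1) :=
  ⟨fun _ hp => ⟨sqrt_le_infMaxPowerSum hn, infMaxPowerSum_le_of_prime hn hp⟩,
    fun _ hj hq => ⟨sqrt_le_infMaxPowerSum hn, infMaxPowerSum_le_of_isPrimePow_add hn hj hq⟩,
    fun hq => ⟨sqrt_le_infMaxPowerSum hn, infMaxPowerSum_le_of_isPrimePow hn hq⟩⟩
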